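/- Let $R$ be a ring and let $i$ be a discrete length function on the category of left $R$-modules, that is, a function $i$ assigning to every left $R$-module a value in $\mathbb R_{\ge 0}\cup\{\infty\}$ such that: $i(0)=0$ and $i(M)=i(N)$ if $M\cong N$; $i(M)=i(N)+i(M/N)$ for every submodule $N$ of $M$; $i(M)=\sup\{i(F): F\le M \text{ finitely generated}\}$ for every $M$; and the finite values of $i$ lie in a subset of $\mathbb R_{\ge 0}$ that is order-isomorphic to $\mathbb N$. For a left $R$-module $M$, an endomorphism $\phi$ of $M$ and a submodule $F$ of $M$, put $T_n(\phi,F)=F+\phi(F)+\dots+\phi^{n-1}(F)$ and $T(\phi,F)=\sum_{n\ge 0}\phi^n(F)$, and let $$\mathrm{ent}_i(\phi)=\sup\Big\{\lim_{n\to\infty}\frac{i(T_n(\phi,F))}{n} \;:\; F\le M,\ i(F)<\infty\Big\}$$ (the limits exist). Let $M$ be a left $R$-module that is locally $i$-finite, i.e. $i(Rx)<\infty$ for every $x\in M$, and let $\phi$ be an endomorphism of $M$. Let $\mathbf P_{\mathrm{ent}_i}(M,\phi)$ be the Pinsker submodule, i.e. the sum of all $\phi$-invariant submodules $N$ of $M$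 with $\mathrm{ent}_i(\phi|_N)=0$. Then $$\mathbf P_{\mathrm{ent}_i}(M,\phi)=t^i_\phi(M):=\{x\in M : i(T(\phi,Rx))<\infty\}.$$ -/

import Mathlib

open Filter Topology
open scoped ENNReal NNReal

universe u v

namespace AlgEntropy

/-! ### Invariants of the category of left `R`-modules -/

section Invariants

variable {R : Type u} [Ring R]

/-- An invariant of `Mod_R`: a function to `[0, ∞]` that vanishes on zero modules and is constant
on isomorphism classes. -/
structure IsInvariant (i : ModuleCat.{v} R → ℝ≥0∞) : Prop where
  zero : ∀ M : ModuleCat.{v} R, Subsingleton M → i M = 0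
  iso : ∀ M N : ModuleCat.{v} R, Nonempty (M ≃ₗ[R] N) → i M = i N

/-- An invariant is additive if `i M = i N + i (M / N)` for every submodule `N` of `M`. -/
structure IsAdditiveInvariant (i : ModuleCat.{v} R → ℝ≥0∞) : Prop extends IsInvariant i where
  additive : ∀ (M : ModuleCat.{v} R) (N : Submodule R M),
    i M = i (ModuleCat.of R N) + i (ModuleCat.of R (M ⧸ N))

/-- A length function: an additive invariant which is upper continuous, that is, `i M` is the
supremum of the values of `i` on the finitely generated submodules of `M`. -/
structure IsLengthFunction (i : ModuleCat.{v} R → ℝ≥0∞) : Prop extends IsAdditiveInvariant i where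
  upper_continuous : ∀ M : ModuleCat.{v} R,
    i M = ⨆ (F : Submodule R M) (_ : F.FG), i (ModuleCat.of R F)

/-- `i` is discrete: its finite values lie in a subset of `[0, ∞)` that is order-isomorphic
to `ℕ`. -/
def IsDiscrete (i : ModuleCat.{v} R → ℝ≥0∞) : Prop :=
  ∃ S : Set ℝ≥0, Nonempty (S ≃o ℕ) ∧ ∀ M : ModuleCat.{v} R, i M = ∞ ∨ ∃ s ∈ S, i M = (s : ℝ≥0∞)

/-- `M` is locally `i`-finite: every cyclic submodule `R x` of `M` has finite `i`-value. -/
def IsLocallyFinite (i : ModuleCat.{v} R → ℝ≥0∞) (M : ModuleCat.{v} R) : Prop :=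
  ∀ x : M, i (ModuleCat.of R (Submodule.span R {x})) < ∞

end Invariants

/-! ### Algebraic flows, trajectories and entropy -/

/-- An algebraic flow `(M, φ)`: a left `R`-module with an endomorphism. -/
structure AlgFlow (R : Type u) [Ring R] where
  carrier : ModuleCat.{v} R
  φ : Module.End R carrier

section Flows

variable {R : Type u} [Ring R]

/-- The subflow `(N, φ|_N)` carried by a `φ`-invariant submodule `N`. -/
def AlgFlow.sub (X : AlgFlow.{u, v} R) (N : Submodule R X.carrier) (hN : ∀ x ∈ N, X.φ x ∈ N) :
    AlgFlow.{u, v} R where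
  carrier := ModuleCat.of R N
  φ := X.φ.restrict hN

variable {M : Type v} [AddCommGroup M] [Module R M]

/-- The `n`-th trajectory `F + φ(F) + ⋯ + φ^(n-1)(F)`. -/
def partialTrajectory (φ : Module.End R M) (F : Submodule R M) (n : ℕ) : Submodule R M :=
  ⨆ k ∈ Finset.range n, F.map (φ ^ k)

/-- The trajectory `∑_{k ∈ ℕ} φ^k(F)`. -/
def trajectory (φ : Module.End R M) (F : Submodule R M) : Submodule R M :=
  ⨆ k : ℕ, F.map (φ ^ k)

/-- The entropy of `φ` with respect to `F`: the limit of `i(T_n(φ, F)) / n`. That this limit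
exists if `i` is an additive invariant and `i F < ∞` is `tendsto_entropyAt` below. -/
noncomputable def entropyAt (i : ModuleCat.{v} R → ℝ≥0∞) (φ : Module.End R M)
    (F : Submodule R M) : ℝ≥0∞ :=
  limUnder atTop fun n : ℕ => i (ModuleCat.of R (partialTrajectory φ F n)) / (n : ℝ≥0∞)

/-- The `i`-entropy of a flow: the supremum of the entropies with respect to all submodules of
finite `i`-value. -/
noncomputable def entropy (i : ModuleCat.{v} R → ℝ≥0∞) (X : AlgFlow.{u, v} R) : ℝ≥0∞ :=
  ⨆ (F : Submodule R X.carrier) (_ : i (ModuleCat.of R F) < ∞), entropyAt i X.φ F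

/-- The Pinsker submodule of a flow with respect to a function `h` on flows: the join of all
subobjects of the flow (that is, of all invariant submodules) on which `h` vanishes. -/
def pinsker (h : AlgFlow.{u, v} R → ℝ≥0∞) (X : AlgFlow.{u, v} R) : Submodule R X.carrier :=
  sSup {N | ∃ hN : ∀ x ∈ N, X.φ x ∈ N, h (X.sub N hN) = 0}

/-- The Pinsker submodule is `φ`-invariant, hence a subobject of the flow. -/
theorem pinsker_invariant (h : AlgFlow.{u, v} R → ℝ≥0∞) (X : AlgFlow.{u, v} R) :
    ∀ x ∈ pinsker h X, X.φ x ∈ pinsker h X := by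
  have : pinsker h X ≤ (pinsker h X).comap X.φ := by
    refine sSup_le fun N hN x hx => ?_
    exact (le_sSup hN : N ≤ pinsker h X) (hN.1 x hx)
  exact this

/-- The set of all `x` whose trajectory `T(φ, R x)` has finite `i`-value. -/
def torsionSet (i : ModuleCat.{v} R → ℝ≥0∞) (X : AlgFlow.{u, v} R) : Set X.carrier :=
  {x | i (ModuleCat.of R (trajectory X.φ (Submodule.span R {x}))) < ∞}

/-! ### The limit in the definition of the entropy exists -/

theorem IsAdditiveInvariant.le_of_surjective {i : ModuleCat.{v} R → ℝ≥0∞}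
    (hi : IsAdditiveInvariant i) {A B : Type v} [AddCommGroup A] [Module R A] [AddCommGroup B]
    [Module R B] (f : A →ₗ[R] B) (hf : Function.Surjective f) :
    i (ModuleCat.of R B) ≤ i (ModuleCat.of R A) := by
  rw [hi.additive (ModuleCat.of R A) (LinearMap.ker f),
    hi.iso (ModuleCat.of R B) (ModuleCat.of R (A ⧸ LinearMap.ker f))
      ⟨(f.quotKerEquivOfSurjective hf).symm⟩]
  exact le_add_self

theorem IsAdditiveInvariant.map_le {i : ModuleCat.{v} R → ℝ≥0∞}
    (hi : IsAdditiveInvariant i) (f : Module.End R M) (F : Submodule R M) :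
    i (ModuleCat.of R (F.map f)) ≤ i (ModuleCat.of R F) :=
  hi.le_of_surjective (f.submoduleMap F) (f.submoduleMap_surjective F)

theorem IsAdditiveInvariant.sup_le {i : ModuleCat.{v} R → ℝ≥0∞}
    (hi : IsAdditiveInvariant i) (A B : Submodule R M) :
    i (ModuleCat.of R (A ⊔ B : Submodule R M)) ≤ i (ModuleCat.of R A) + i (ModuleCat.of R B) := by
  rw [hi.additive (ModuleCat.of R (A ⊔ B : Submodule R M)) (A.submoduleOf (A ⊔ B))]
  refine add_le_add (le_of_eq (hi.iso _ _ ⟨Submodule.submoduleOfEquivOfLe le_sup_left⟩)) ?_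
  refine hi.le_of_surjective
    ((A.submoduleOf (A ⊔ B)).mkQ ∘ₗ Submodule.inclusion (le_sup_right : B ≤ A ⊔ B)) ?_
  intro y
  obtain ⟨⟨z, hz⟩, rfl⟩ := Submodule.mkQ_surjective _ y
  obtain ⟨a, ha, b, hb, rfl⟩ := Submodule.mem_sup.1 hz
  refine ⟨⟨b, hb⟩, ?_⟩
  rw [LinearMap.comp_apply, Submodule.mkQ_apply, Submodule.mkQ_apply, Submodule.Quotient.eq]
  change b - (a + b) ∈ A
  simpa using ha

theorem partialTrajectory_add (φ : Module.End R M) (F : Submodule R M) (m n : ℕ) :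
    partialTrajectory φ F (m + n) =
      partialTrajectory φ F m ⊔ (partialTrajectory φ F n).map (φ ^ m) := by
  simp only [partialTrajectory, Submodule.map_iSup, ← Submodule.map_comp, Finset.mem_range]
  apply le_antisymm
  · refine iSup₂_le fun k hk => ?_
    rcases lt_or_ge k m with h | h
    · exact le_sup_of_le_left (le_iSup₂_of_le k h le_rfl)
    · refine le_sup_of_le_right (le_iSup₂_of_le (k - m) (by omega) ?_)
      rw [← Module.End.mul_eq_comp, ← pow_add, Nat.add_sub_cancel' h]
  · refine sup_le (iSup₂_le fun k hk => le_iSup₂_of_le k (by omega) le_rfl)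
      (iSup₂_le fun k hk => le_iSup₂_of_le (m + k) (by omega) ?_)
    rw [← Module.End.mul_eq_comp, ← pow_add]

/-- For an additive invariant `i` and a submodule `F` with `i F < ∞`, the entropy of `φ` with
respect to `F` is a genuine limit. -/
theorem tendsto_entropyAt {i : ModuleCat.{v} R → ℝ≥0∞} (hi : IsAdditiveInvariant i)
    (φ : Module.End R M) (F : Submodule R M) (hF : i (ModuleCat.of R F) < ∞) :
    Tendsto (fun n : ℕ => i (ModuleCat.of R (partialTrajectory φ F n)) / (n : ℝ≥0∞)) atTop
      (𝓝 (entropyAt i φ F)) := by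
  set a : ℕ → ℝ≥0∞ := fun n => i (ModuleCat.of R (partialTrajectory φ F n)) with ha
  have hsub : ∀ m n, a (m + n) ≤ a m + a n := fun m n => by
    simp only [ha]
    rw [partialTrajectory_add]
    exact (hi.sup_le _ _).trans (add_le_add le_rfl (hi.map_le _ _))
  have h0 : a 0 = 0 := by
    refine hi.zero _ ?_
    have : partialTrajectory φ F 0 = ⊥ := by simp [partialTrajectory]
    rw [this]
    change Subsingleton (⊥ : Submodule R M)
    infer_instance
  have h1 : a 1 < ∞ := by
    have : partialTrajectory φ F 1 = F.map (φ ^ 0) := by simp [partialTrajectory]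
    simp only [ha]
    rw [this]
    exact (hi.map_le _ _).trans_lt hF
  have hfin : ∀ n, a n ≠ ∞ := fun n => by
    induction n with
    | zero => simp [h0]
    | succ n ih => exact ne_top_of_le_ne_top (ENNReal.add_ne_top.2 ⟨ih, h1.ne⟩) (hsub n 1)
  have hs : Subadditive fun n => (a n).toReal := fun m n => by
    rw [← ENNReal.toReal_add (hfin m) (hfin n)]
    exact ENNReal.toReal_mono (ENNReal.add_ne_top.2 ⟨hfin m, hfin n⟩) (hsub m n)
  have ht := hs.tendsto_lim ⟨0, by rintro _ ⟨n, rfl⟩; positivity⟩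
  have ht' := ENNReal.tendsto_ofReal ht
  have : Tendsto (fun n : ℕ => a n / (n : ℝ≥0∞)) atTop (𝓝 (ENNReal.ofReal hs.lim)) := by
    refine ht'.congr' ?_
    filter_upwards [eventually_gt_atTop 0] with n hn
    rw [ENNReal.ofReal_div_of_pos (by exact_mod_cast hn), ENNReal.ofReal_toReal (hfin n),
      ENNReal.ofReal_natCast]
  exact tendsto_nhds_limUnder ⟨_, this⟩

end Flows

end AlgEntropy

/-!
For a submodule `F` with `i F < ∞` write `T n` for its `n`-th trajectory. Since `φ` induces
surjections `T (n + 1) / T n → T (n + 2) / T (n + 1)`, the increments `i (T (n + 1) / T n)` of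
`i (T n)` decrease in `n` (`increment_antitone`). Discreteness bounds the nonzero finite values of
`i` below by some `δ > 0` (`IsDiscrete.exists_gap`). So either all increments are at least `δ`, and
then the entropy at `F` is at least `δ`, or they vanish from some point on, and then `i (T n)` is
bounded and `i` is finite on the full trajectory by upper continuity
(`trajectory_lt_top_of_entropyAt_eq_zero`).

Consequently, in an invariant submodule of zero entropy every cyclic submodule has a trajectory of
finite value. The elements with this property form a submodule (`torsionSubmodule`), hence it
contains the Pinsker submodule. Conversely, a trajectory of finite value is an invariant submodule
all of whose trajectories have bounded value, so its entropy is zero.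
-/

namespace AlgEntropy

variable {R : Type u} [Ring R] {i : ModuleCat.{v} R → ℝ≥0∞}
variable {M : Type v} [AddCommGroup M] [Module R M]

/-! ### Additive invariants and discreteness -/

theorem IsAdditiveInvariant.le_of_injective (hi : IsAdditiveInvariant i) {A B : Type v}
    [AddCommGroup A] [Module R A] [AddCommGroup B] [Module R B] (f : A →ₗ[R] B)
    (hf : Function.Injective f) : i (ModuleCat.of R A) ≤ i (ModuleCat.of R B) := by
  rw [hi.additive (ModuleCat.of R B) (LinearMap.range f),
    hi.iso (ModuleCat.of R A) (ModuleCat.of R (LinearMap.range f))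
      ⟨LinearEquiv.ofInjective f hf⟩]
  exact le_self_add

theorem IsAdditiveInvariant.mono (hi : IsAdditiveInvariant i) {A B : Submodule R M}
    (h : A ≤ B) : i (ModuleCat.of R A) ≤ i (ModuleCat.of R B) :=
  hi.le_of_injective (Submodule.inclusion h) (Submodule.inclusion_injective h)

/-- A set order-isomorphic to `ℕ` is well-ordered, so its nonzero elements have a minimum. -/
theorem IsDiscrete.exists_gap (hd : IsDiscrete i) :
    ∃ δ : ℝ≥0∞, 0 < δ ∧ ∀ N : ModuleCat.{v} R, i N ≠ 0 → δ ≤ i N := by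
  obtain ⟨S, ⟨e⟩, hS⟩ := hd
  by_cases hne : ∃ s : S, (s : ℝ≥0) ≠ 0
  · have wf : WellFounded ((· < ·) : S → S → Prop) := e.toOrderEmbedding.wellFounded wellFounded_lt
    refine ⟨((wf.min {s : S | (s : ℝ≥0) ≠ 0} hne : S) : ℝ≥0), ?_, fun N hN => ?_⟩
    · exact_mod_cast pos_iff_ne_zero.2 (wf.min_mem {s : S | (s : ℝ≥0) ≠ 0} hne)
    · rcases hS N with h | ⟨s, hs, h⟩
      · simp [h]
      · rw [h] at hN ⊢
        have := wf.not_lt_min {s : S | (s : ℝ≥0) ≠ 0} (x := ⟨s, hs⟩) (by simpa using hN)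
        exact_mod_cast not_lt.1 this
  · refine ⟨∞, ENNReal.zero_lt_top, fun N hN => ?_⟩
    rcases hS N with h | ⟨s, hs, h⟩
    · simp [h]
    · exact absurd ⟨⟨s, hs⟩, by simpa [h] using hN⟩ hne

/-! ### Trajectories -/

theorem partialTrajectory_zero (φ : Module.End R M) (F : Submodule R M) :
    partialTrajectory φ F 0 = ⊥ := by
  simp [partialTrajectory]

theorem partialTrajectory_succ (φ : Module.End R M) (F : Submodule R M) (n : ℕ) :
    partialTrajectory φ F (n + 1) = partialTrajectory φ F n ⊔ F.map (φ ^ n) := by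
  rw [partialTrajectory_add]
  simp [partialTrajectory, Module.End.one_eq_id]

theorem partialTrajectory_mono (φ : Module.End R M) (F : Submodule R M) :
    Monotone (partialTrajectory φ F) :=
  monotone_nat_of_le_succ fun n => by
    rw [partialTrajectory_succ]
    exact le_sup_left

theorem map_partialTrajectory_le (φ : Module.End R M) (F : Submodule R M) (n : ℕ) :
    (partialTrajectory φ F n).map φ ≤ partialTrajectory φ F (n + 1) := by
  rw [add_comm, partialTrajectory_add, pow_one]
  exact le_sup_right

theorem trajectory_eq_iSup_partialTrajectory (φ : Module.End R M) (F : Submodule R M) :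
    trajectory φ F = ⨆ n, partialTrajectory φ F n := by
  refine le_antisymm (iSup_le fun k => ?_) (iSup_le fun n => iSup₂_le fun k _ => ?_)
  · refine le_trans ?_ (le_iSup _ (k + 1))
    rw [partialTrajectory_succ]
    exact le_sup_right
  · exact le_iSup (fun k : ℕ => F.map (φ ^ k)) k

theorem le_trajectory (φ : Module.End R M) (F : Submodule R M) : F ≤ trajectory φ F := by
  refine le_trans ?_ (le_iSup (fun k : ℕ => F.map (φ ^ k)) 0)
  simp [Module.End.one_eq_id]

theorem trajectory_invariant (φ : Module.End R M) (F : Submodule R M) :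
    ∀ x ∈ trajectory φ F, φ x ∈ trajectory φ F := by
  have h : (trajectory φ F).map φ ≤ trajectory φ F := by
    simp only [trajectory, Submodule.map_iSup, ← Submodule.map_comp]
    refine iSup_le fun k => ?_
    rw [← Module.End.mul_eq_comp, ← pow_succ']
    exact le_iSup (fun k : ℕ => F.map (φ ^ k)) (k + 1)
  exact fun x hx => h (Submodule.mem_map_of_mem hx)

theorem trajectory_mono (φ : Module.End R M) {F G : Submodule R M} (h : F ≤ G) :
    trajectory φ F ≤ trajectory φ G :=
  iSup_mono fun _ => Submodule.map_mono h

theorem trajectory_sup (φ : Module.End R M) (F G : Submodule R M) :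
    trajectory φ (F ⊔ G) = trajectory φ F ⊔ trajectory φ G := by
  simp only [trajectory, Submodule.map_sup, iSup_sup_eq]

theorem map_subtype_trajectory_restrict {φ : Module.End R M} {N : Submodule R M}
    (hN : ∀ x ∈ N, φ x ∈ N) (F : Submodule R N) :
    (trajectory (φ.restrict hN) F).map N.subtype = trajectory φ (F.map N.subtype) := by
  simp only [trajectory, Submodule.map_iSup, ← Submodule.map_comp]
  refine iSup_congr fun k => congrArg (fun f => Submodule.map f F) (LinearMap.ext fun x => ?_)
  change (((φ.restrict hN) ^ k) x : M) = (φ ^ k) x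
  rw [Module.End.pow_restrict k hN]
  rfl

/-- Every finitely generated submodule of the trajectory lies in some partial trajectory. -/
theorem trajectory_le_of_partialTrajectory_le (hi : IsLengthFunction i) (φ : Module.End R M)
    (F : Submodule R M) {c : ℝ≥0∞} (hc : ∀ n, i (ModuleCat.of R (partialTrajectory φ F n)) ≤ c) :
    i (ModuleCat.of R (trajectory φ F)) ≤ c := by
  rw [hi.upper_continuous]
  refine iSup₂_le fun G hG => ?_
  have hG' : (G.map (trajectory φ F).subtype).FG := hG.map _
  have hle : G.map (trajectory φ F).subtype ≤ ⨆ n, partialTrajectory φ F n := by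
    rw [← trajectory_eq_iSup_partialTrajectory]
    exact Submodule.map_subtype_le _ _
  obtain ⟨_, ⟨n, rfl⟩, hn⟩ :=
    (CompleteLattice.isCompactElement_iff_le_of_directed_sSup_le _ _).1
      ((Submodule.fg_iff_compact _).1 hG') (Set.range (partialTrajectory φ F))
      (Set.range_nonempty _) (partialTrajectory_mono φ F).directed_le.directedOn_range hle
  refine le_trans ?_ (hc n)
  rw [hi.iso _ (ModuleCat.of R (G.map (trajectory φ F).subtype))
    ⟨Submodule.equivMapOfInjective _ (Submodule.subtype_injective _) G⟩]
  exact hi.mono hn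

/-! ### Increments along the partial trajectories -/

/-- The value of `i` on the quotient of consecutive partial trajectories. -/
noncomputable def increment (i : ModuleCat.{v} R → ℝ≥0∞) (φ : Module.End R M)
    (F : Submodule R M) (n : ℕ) : ℝ≥0∞ :=
  i (ModuleCat.of R (partialTrajectory φ F (n + 1) ⧸
    (partialTrajectory φ F n).submoduleOf (partialTrajectory φ F (n + 1))))

theorem partialTrajectory_succ_eq_add_increment (hi : IsAdditiveInvariant i)
    (φ : Module.End R M) (F : Submodule R M) (n : ℕ) :
    i (ModuleCat.of R (partialTrajectory φ F (n + 1))) =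
      i (ModuleCat.of R (partialTrajectory φ F n)) + increment i φ F n := by
  rw [hi.additive (ModuleCat.of R (partialTrajectory φ F (n + 1)))
    ((partialTrajectory φ F n).submoduleOf (partialTrajectory φ F (n + 1)))]
  congr 1
  exact hi.iso _ _
    ⟨Submodule.submoduleOfEquivOfLe (partialTrajectory_mono φ F (Nat.le_succ n))⟩

theorem increment_antitone (hi : IsAdditiveInvariant i) (φ : Module.End R M)
    (F : Submodule R M) : Antitone (increment i φ F) := by
  refine antitone_nat_of_succ_le fun n => ?_
  have hmaps (m : ℕ) : ∀ x ∈ partialTrajectory φ F m, φ x ∈ partialTrajectory φ F (m + 1) :=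
    fun x hx => map_partialTrajectory_le φ F m (Submodule.mem_map_of_mem hx)
  refine hi.le_of_surjective (Submodule.mapQ
    ((partialTrajectory φ F n).submoduleOf (partialTrajectory φ F (n + 1)))
    ((partialTrajectory φ F (n + 1)).submoduleOf (partialTrajectory φ F (n + 1 + 1)))
    (φ.restrict (hmaps (n + 1))) fun x hx => Submodule.mem_comap.2 (hmaps n x hx)) fun y => ?_
  obtain ⟨⟨y, hy⟩, rfl⟩ := Submodule.mkQ_surjective _ y
  obtain ⟨t, ht, _, ⟨f, hf, rfl⟩, rfl⟩ := Submodule.mem_sup.1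
    ((partialTrajectory_succ φ F (n + 1)).le hy)
  have hmem : (φ ^ n) f ∈ partialTrajectory φ F (n + 1) := by
    rw [partialTrajectory_succ]
    exact Submodule.mem_sup_right (Submodule.mem_map_of_mem hf)
  refine ⟨Submodule.Quotient.mk ⟨(φ ^ n) f, hmem⟩, ?_⟩
  refine (Submodule.Quotient.eq _).2 ?_
  change φ ((φ ^ n) f) - (t + (φ ^ (n + 1)) f) ∈ partialTrajectory φ F (n + 1)
  rw [pow_succ', Module.End.mul_apply]
  simpa using ht

theorem partialTrajectory_lt_top (hi : IsAdditiveInvariant i) (φ : Module.End R M)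
    {F : Submodule R M} (hF : i (ModuleCat.of R F) < ∞) (n : ℕ) :
    i (ModuleCat.of R (partialTrajectory φ F n)) < ∞ := by
  induction n with
  | zero =>
    rw [partialTrajectory_zero, hi.zero (ModuleCat.of R (⊥ : Submodule R M))
      (inferInstanceAs (Subsingleton (⊥ : Submodule R M)))]
    exact ENNReal.zero_lt_top
  | succ n ih =>
    rw [partialTrajectory_succ]
    exact (hi.sup_le _ _).trans_lt (ENNReal.add_lt_top.2 ⟨ih, (hi.map_le _ _).trans_lt hF⟩)

/-! ### Zero entropy and trajectories of finite value -/

theorem trajectory_lt_top_of_entropyAt_eq_zero (hi : IsLengthFunction i) (hd : IsDiscrete i)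
    (φ : Module.End R M) {F : Submodule R M} (hF : i (ModuleCat.of R F) < ∞)
    (h0 : entropyAt i φ F = 0) : i (ModuleCat.of R (trajectory φ F)) < ∞ := by
  have ha := hi.toIsAdditiveInvariant
  obtain ⟨δ, hδ, hgap⟩ := hd.exists_gap
  obtain ⟨n, hn⟩ : ∃ n, increment i φ F n = 0 := by
    by_contra! hne
    -- Otherwise `i (T n) ≥ n * δ` for all `n`, and the entropy would be at least `δ`.
    have hlow (n : ℕ) : δ * n ≤ i (ModuleCat.of R (partialTrajectory φ F n)) := by
      induction n with
      | zero => simp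
      | succ n ih =>
        rw [partialTrajectory_succ_eq_add_increment ha, Nat.cast_succ, mul_add, mul_one]
        exact add_le_add ih (hgap _ (hne n))
    have hle : δ ≤ entropyAt i φ F := by
      refine ge_of_tendsto (tendsto_entropyAt ha φ F hF) ?_
      filter_upwards [eventually_gt_atTop 0] with n hn
      rw [ENNReal.le_div_iff_mul_le (by simp [hn.ne']) (by simp)]
      exact hlow n
    exact hδ.not_ge (h0 ▸ hle)
  have hstable (k : ℕ) : i (ModuleCat.of R (partialTrajectory φ F (n + k))) ≤
      i (ModuleCat.of R (partialTrajectory φ F n)) := by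
    induction k with
    | zero => rfl
    | succ k ih =>
      have hz : increment i φ F (n + k) = 0 :=
        nonpos_iff_eq_zero.1 (hn ▸ increment_antitone ha φ F (Nat.le_add_right n k))
      rw [← add_assoc, partialTrajectory_succ_eq_add_increment ha, hz, add_zero]
      exact ih
  refine (trajectory_le_of_partialTrajectory_le hi φ F fun m => ?_).trans_lt
    (partialTrajectory_lt_top ha φ hF n)
  exact (ha.mono (partialTrajectory_mono φ F (Nat.le_add_left m n))).trans (hstable m)

theorem entropy_eq_zero_of_lt_top (hi : IsAdditiveInvariant i) (X : AlgFlow.{u, v} R)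
    (hX : i X.carrier < ∞) : entropy i X = 0 := by
  refine nonpos_iff_eq_zero.1 (iSup₂_le fun F hF => ?_)
  have hbound : Tendsto (fun n : ℕ => i X.carrier / (n : ℝ≥0∞)) atTop (𝓝 0) := by
    simpa using ENNReal.Tendsto.const_div ENNReal.tendsto_nat_nhds_top (Or.inr hX.ne)
  refine le_of_tendsto_of_tendsto' (tendsto_entropyAt hi X.φ F hF) hbound fun n => ?_
  exact ENNReal.div_le_div_right
    (hi.le_of_injective (Submodule.subtype _) (Submodule.subtype_injective _)) _

/-! ### The torsion submodule -/

/-- The elements whose trajectory has finite `i`-value, as a submodule with underlying set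
`torsionSet i X`. -/
def torsionSubmodule (hi : IsAdditiveInvariant i) (X : AlgFlow.{u, v} R) :
    Submodule R X.carrier where
  carrier := torsionSet i X
  zero_mem' := by
    have hbot : trajectory X.φ (Submodule.span R {0}) = ⊥ := by simp [trajectory]
    change i _ < ∞
    rw [hbot, hi.zero (ModuleCat.of R (⊥ : Submodule R X.carrier))
      (inferInstanceAs (Subsingleton (⊥ : Submodule R X.carrier)))]
    exact ENNReal.zero_lt_top
  add_mem' {x y} hx hy := by
    have hle : Submodule.span R {x + y} ≤ Submodule.span R {x} ⊔ Submodule.span R {y} := by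
      rw [Submodule.span_singleton_le_iff_mem]
      exact Submodule.add_mem_sup (Submodule.mem_span_singleton_self x)
        (Submodule.mem_span_singleton_self y)
    have hle' := trajectory_mono X.φ hle
    rw [trajectory_sup] at hle'
    exact ((hi.mono hle').trans (hi.sup_le _ _)).trans_lt (ENNReal.add_lt_top.2 ⟨hx, hy⟩)
  smul_mem' r x hx :=
    (hi.mono (trajectory_mono X.φ (Submodule.span_singleton_smul_le R r x))).trans_lt hx

/-- Zero entropy on an invariant submodule makes `i` finite on the trajectories of its elements;
a trajectory is the same whether formed in the submodule or in the whole module. -/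
theorem le_torsionSubmodule_of_entropy_eq_zero (hi : IsLengthFunction i) (hd : IsDiscrete i)
    (X : AlgFlow.{u, v} R) (hX : IsLocallyFinite i X.carrier) {N : Submodule R X.carrier}
    (hN : ∀ x ∈ N, X.φ x ∈ N) (h0 : entropy i (X.sub N hN) = 0) :
    N ≤ torsionSubmodule hi.toIsAdditiveInvariant X := by
  intro x hx
  have ha := hi.toIsAdditiveInvariant
  let F : Submodule R N := Submodule.span R {⟨x, hx⟩}
  have hFx : F.map N.subtype = Submodule.span R {x} := by
    simp [F, Submodule.map_span]
  have hF : i (ModuleCat.of R F) < ∞ := by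
    rw [hi.iso _ (ModuleCat.of R (F.map N.subtype))
      ⟨Submodule.equivMapOfInjective _ (Submodule.subtype_injective _) F⟩, hFx]
    exact hX x
  have hent : entropyAt i (X.φ.restrict hN) F = 0 :=
    nonpos_iff_eq_zero.1 (h0 ▸ le_iSup₂_of_le (f := fun (F : Submodule R N)
      (_ : i (ModuleCat.of R F) < ∞) => entropyAt i (X.φ.restrict hN) F) F hF le_rfl)
  have hfin := trajectory_lt_top_of_entropyAt_eq_zero hi hd (X.φ.restrict hN) hF hent
  change i _ < ∞
  rw [← hFx, ← map_subtype_trajectory_restrict hN]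
  exact (ha.le_of_surjective (N.subtype.submoduleMap _)
    (N.subtype.submoduleMap_surjective _)).trans_lt hfin

end AlgEntropy

theorem theorem5p14 {R : Type u} [Ring R] (i : ModuleCat.{v} R → ℝ≥0∞)
    (hi : AlgEntropy.IsLengthFunction i) (hd : AlgEntropy.IsDiscrete i)
    (X : AlgEntropy.AlgFlow.{u, v} R) (hX : AlgEntropy.IsLocallyFinite i X.carrier) :
    (AlgEntropy.pinsker (AlgEntropy.entropy i) X : Set X.carrier) =
      AlgEntropy.torsionSet i X := by
  refine Set.Subset.antisymm ?_ fun x hx => ?_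
  · have hle : AlgEntropy.pinsker (AlgEntropy.entropy i) X ≤
        AlgEntropy.torsionSubmodule hi.toIsAdditiveInvariant X :=
      sSup_le fun N ⟨hN, h0⟩ =>
        AlgEntropy.le_torsionSubmodule_of_entropy_eq_zero hi hd X hX hN h0
    exact hle
  · have hle : AlgEntropy.trajectory X.φ (Submodule.span R {x}) ≤
        AlgEntropy.pinsker (AlgEntropy.entropy i) X :=
      le_sSup ⟨AlgEntropy.trajectory_invariant X.φ _,
        AlgEntropy.entropy_eq_zero_of_lt_top hi.toIsAdditiveInvariant _ hx⟩
    exact hle (AlgEntropy.le_trajectory X.φ _ (Submodule.mem_span_singleton_self x))
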